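/- Let $s\ge 1$ and let $p(x,y)$ be a real binary form of degree $2s$. A representation $p(x,y)=\sum_{j=1}^r\lambda_j(\alpha_jx+\beta_jy)^{2s}$ ($r\ge 0$) with nonzero real $\lambda_j$ and nonzero real linear forms $\alpha_jx+\beta_jy$ is called honest if no two of these linear forms are proportional; its badge is the pair $(a,b)$, where $a$ is the number of positive and $b$ the number of negative $\lambda_j$. Order pairs componentwise: $(a,b)\preceq(c,d)$ if $a\le c$ and $b\le d$. A signature of $p$ is a minimal element, for $\preceq$, of the set of badges of all honest representations of $p$, and $\mathcal S(p)$ denotes the set of signatures of $p$. Corollary 4.3. If $p$ is a real binary sextic form (that is, $2s=6$) and $|\mathcal S(p)|\ge 2$, then $\mathcal S(p)=\{(2,3),(3,2)\}$. -/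

import Mathlib

namespace RealForm

/-- The real linear form `α₁ x₁ + ⋯ + αₙ xₙ` with coefficient vector `α`. -/
noncomputable def linearForm {n : ℕ} (α : Fin n → ℝ) : MvPolynomial (Fin n) ℝ :=
  ∑ i, MvPolynomial.C (α i) * MvPolynomial.X i

/-- `p = ∑ j, lam j * (linearForm (α j)) ^ (2 * s)` is an honest representation of `p`:
all coefficients are non-zero, all linear forms are non-zero, and no two of the linear
forms are proportional.  The empty representation (`r = 0`, of the zero form) is allowed. -/
structure IsHonestRep {n : ℕ} (s : ℕ) (p : MvPolynomial (Fin n) ℝ) {r : ℕ}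
    (lam : Fin r → ℝ) (α : Fin r → Fin n → ℝ) : Prop where
  coeff_ne_zero : ∀ j, lam j ≠ 0
  form_ne_zero : ∀ j, α j ≠ 0
  distinct : ∀ j k, j ≠ k → LinearIndependent ℝ ![α j, α k]
  eq_sum : p = ∑ j, MvPolynomial.C (lam j) * linearForm (α j) ^ (2 * s)

open Classical in
/-- The badge of a representation with coefficients `lam`: the number of positive
and the number of negative coefficients. -/
noncomputable def badge {r : ℕ} (lam : Fin r → ℝ) : ℕ × ℕ :=
  ((Finset.univ.filter fun j => 0 < lam j).card, (Finset.univ.filter fun j => lam j < 0).card)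

/-- The set of badges of the honest representations of `p`, a form of degree `2 * s`. -/
def badges {n : ℕ} (s : ℕ) (p : MvPolynomial (Fin n) ℝ) : Set (ℕ × ℕ) :=
  {ab | ∃ (r : ℕ) (lam : Fin r → ℝ) (α : Fin r → Fin n → ℝ),
    IsHonestRep s p lam α ∧ badge lam = ab}

/-- The set of signatures of `p`: the badges that are minimal for the componentwise order
of `ℕ × ℕ`. -/
def signatures {n : ℕ} (s : ℕ) (p : MvPolynomial (Fin n) ℝ) : Set (ℕ × ℕ) :=
  {ab | Minimal (fun cd => cd ∈ badges s p) ab}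

end RealForm

/-! Apolarity turns the sextic into a functional `L` on polynomials of degree at most 6. Honest
representations become expressions of `L` as weighted sums of evaluations at distinct points of the
real projective line, with badges as sign counts of the weights. Signs are controlled by the
quadratic form q ↦ L(q²) on cubics.

Two facts carry the proof. A representation with at most four points has the least badge, because a
cubic can vanish at any three points and not at a fourth (`Represents.numPos_le_numPos`). A
functional nonnegative on squares is, for any chosen point x, a multiple of evaluation at x plus a
nonnegative combination of at most three evaluations (`NonnegOnSquares.exists_represents_sub`).
Applying the latter to the negative part, with x a positive point, either leaves at most three
negative weights or loses a positive point, and then one iterates (`Represents.exists_numPos_le`).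

Two signatures exclude a least badge, so every representation has at least five points. Reduction on
both signs then bounds both counts below by 2. Were (2,3) or (3,2) not attained, one of (3,2),
(2,3), (3,3) would be least. -/

namespace RealForm
open Polynomial

/-! ### Binary forms on the real projective line -/

/-- Evaluation at a point of the projective line `ℝ ∪ {∞}` of the binary form of degree `d`
whose dehomogenization is the given polynomial. -/
noncomputable def pointEval (d : ℕ) : Option ℝ → ℝ[X] →ₗ[ℝ] ℝ
  | some s => Polynomial.leval s
  | none => Polynomial.lcoeff ℝ d

/-- The dehomogenized linear form vanishing at a point of the projective line. -/
noncomputable def vanishing : Option ℝ → ℝ[X]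
  | some s => X - C s
  | none => 1

@[simp] lemma pointEval_some (d : ℕ) (s : ℝ) (f : ℝ[X]) : pointEval d (some s) f = f.eval s := rfl

@[simp] lemma pointEval_none (d : ℕ) (f : ℝ[X]) : pointEval d none f = f.coeff d := rfl

lemma pointEval_mul {d e : ℕ} {f g : ℝ[X]} (hf : f.natDegree ≤ d) (hg : g.natDegree ≤ e)
    (x : Option ℝ) : pointEval (d + e) x (f * g) = pointEval d x f * pointEval e x g := by
  cases x with
  | none => exact coeff_mul_add_eq_of_natDegree_le hf hg
  | some s => simp

lemma natDegree_vanishing_le (x : Option ℝ) : (vanishing x).natDegree ≤ 1 := by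
  cases x <;> simp [vanishing]

lemma vanishing_ne_zero (x : Option ℝ) : vanishing x ≠ 0 := by
  cases x with
  | none => simp [vanishing]
  | some s => exact X_sub_C_ne_zero s

lemma pointEval_vanishing_self (x : Option ℝ) : pointEval 1 x (vanishing x) = 0 := by
  cases x <;> simp [vanishing, coeff_one]

lemma pointEval_vanishing_ne_zero {x y : Option ℝ} (h : x ≠ y) :
    pointEval 1 y (vanishing x) ≠ 0 := by
  cases x <;> cases y <;> simp_all [vanishing, sub_eq_zero, coeff_X, eq_comm]

lemma natDegree_mul_le_add {d e : ℕ} {f g : ℝ[X]} (hf : f.natDegree ≤ d) (hg : g.natDegree ≤ e) :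
    (f * g).natDegree ≤ d + e := natDegree_mul_le.trans (add_le_add hf hg)

lemma exists_eq_vanishing_mul {d : ℕ} {f : ℝ[X]} {x : Option ℝ} (hf : f.natDegree ≤ d + 1)
    (h : pointEval (d + 1) x f = 0) : ∃ g : ℝ[X], g.natDegree ≤ d ∧ f = vanishing x * g := by
  cases x with
  | none =>
    -- At infinity the quotient is `f` itself: the vanishing top coefficient only lowers the degree
    -- bound.
    refine ⟨f, ?_, by simp [vanishing]⟩
    rw [pointEval_none] at h
    by_contra! hlt
    have : f.natDegree = d + 1 := by omega
    rw [← this] at h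
    have : f = 0 := leadingCoeff_eq_zero.1 h
    simp [this] at hlt
  | some s =>
    refine ⟨f /ₘ (X - C s), ?_, (mul_divByMonic_eq_iff_isRoot.2 h).symm⟩
    rw [natDegree_divByMonic _ (monic_X_sub_C s), natDegree_X_sub_C]
    omega

lemma exists_eq_prod_vanishing_mul (T : Finset (Option ℝ)) : ∀ {d : ℕ} {f : ℝ[X]},
    f.natDegree ≤ T.card + d → (∀ x ∈ T, pointEval (T.card + d) x f = 0) →
    ∃ g : ℝ[X], g.natDegree ≤ d ∧ f = (∏ x ∈ T, vanishing x) * g := by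
  classical
  induction T using Finset.induction_on with
  | empty => intro d f hf _; exact ⟨f, by simpa using hf, by simp⟩
  | insert a T ha ih =>
    intro d f hf h
    rw [Finset.card_insert_of_notMem ha] at hf h
    have e : T.card + 1 + d = (T.card + d) + 1 := by ring
    rw [e] at hf h
    obtain ⟨g, hg, rfl⟩ := exists_eq_vanishing_mul hf (h a (Finset.mem_insert_self _ _))
    obtain ⟨k, hk, rfl⟩ := ih hg fun x hx => by
      have h1 := h x (Finset.mem_insert_of_mem hx)
      rw [add_comm, pointEval_mul (natDegree_vanishing_le a) hg] at h1
      exact (mul_eq_zero.1 h1).resolve_left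
        (pointEval_vanishing_ne_zero (by rintro rfl; exact ha hx))
    exact ⟨k, hk, by rw [Finset.prod_insert ha, mul_assoc]⟩

/-- Multiply linear forms vanishing on `T`, padding up to degree `d` with a linear form that is
nonzero at `x`. -/
lemma exists_pointEval_eq_zero_of_card_le (T : Finset (Option ℝ)) {x : Option ℝ} :
    x ∉ T → ∀ {d : ℕ}, T.card ≤ d →
    ∃ q : ℝ[X], q.natDegree ≤ d ∧ (∀ y ∈ T, pointEval d y q = 0) ∧ pointEval d x q ≠ 0 := by
  classical
  induction T using Finset.induction_on with
  | empty =>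
    intro _ d _
    obtain ⟨y, hy⟩ := exists_ne x
    induction d with
    | zero => exact ⟨1, by simp, by simp, by cases x <;> simp⟩
    | succ d ih =>
      obtain ⟨q, hq, -, hx⟩ := ih (by simp)
      refine ⟨q * vanishing y, natDegree_mul_le_add hq (natDegree_vanishing_le y), by simp, ?_⟩
      rw [pointEval_mul hq (natDegree_vanishing_le y)]
      exact mul_ne_zero hx (pointEval_vanishing_ne_zero hy)
  | insert a T ha ih =>
    intro hx d hd
    rw [Finset.card_insert_of_notMem ha] at hd
    obtain ⟨e, rfl⟩ : ∃ e, d = e + 1 := ⟨d - 1, by omega⟩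
    rw [Finset.mem_insert, not_or] at hx
    obtain ⟨q, hq, hT, hqx⟩ := ih hx.2 (d := e) (by omega)
    refine ⟨q * vanishing a, natDegree_mul_le_add hq (natDegree_vanishing_le a), ?_, ?_⟩
    · intro y hy
      rw [pointEval_mul hq (natDegree_vanishing_le a)]
      rcases Finset.mem_insert.1 hy with rfl | hy
      · rw [pointEval_vanishing_self, mul_zero]
      · rw [hT y hy, zero_mul]
    · rw [pointEval_mul hq (natDegree_vanishing_le a)]
      exact mul_ne_zero hqx (pointEval_vanishing_ne_zero (Ne.symm hx.1))

/-! ### Representations by point evaluations -/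

/-- `f` gives the weights of a representation of the functional `L` on binary sextics as a
combination of point evaluations. -/
def Represents (L : ℝ[X] →ₗ[ℝ] ℝ) (f : Option ℝ →₀ ℝ) : Prop :=
  ∀ h : ℝ[X], h.natDegree ≤ 6 → L h = f.sum fun x c => c * pointEval 6 x h

open Classical in
/-- The number of points of positive weight. -/
noncomputable def numPos (f : Option ℝ →₀ ℝ) : ℕ := (f.support.filter fun x => 0 < f x).card

/-- A functional on sextics that is nonnegative on the squares of cubics. -/
def NonnegOnSquares (L : ℝ[X] →ₗ[ℝ] ℝ) : Prop :=
  ∀ q : ℝ[X], q.natDegree ≤ 3 → 0 ≤ L (q * q)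

lemma Represents.add {L M : ℝ[X] →ₗ[ℝ] ℝ} {f g : Option ℝ →₀ ℝ} (hf : Represents L f)
    (hg : Represents M g) : Represents (L + M) (f + g) := by
  intro h hh
  rw [LinearMap.add_apply, hf h hh, hg h hh, Finsupp.sum_add_index'] <;> intros <;> ring

lemma Represents.neg {L : ℝ[X] →ₗ[ℝ] ℝ} {f : Option ℝ →₀ ℝ} (hf : Represents L f) :
    Represents (-L) (-f) := by
  intro h hh
  rw [LinearMap.neg_apply, hf h hh, Finsupp.sum_neg_index (by intros; ring)]
  simp [Finsupp.sum]

lemma represents_single (x : Option ℝ) (c : ℝ) :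
    Represents (c • pointEval 6 x) (Finsupp.single x c) := by
  intro h _
  rw [Finsupp.sum_single_index (by ring)]
  simp

lemma numPos_neg_add (f : Option ℝ →₀ ℝ) : numPos f + numPos (-f) = f.support.card := by
  classical
  rw [numPos, numPos, Finsupp.support_neg,
    ← Finset.card_filter_add_card_filter_not (s := f.support) fun x => 0 < f x]
  congr 1
  refine congrArg Finset.card (Finset.ext fun x => ?_)
  rw [Finset.mem_filter, Finset.mem_filter, Finsupp.neg_apply, Finsupp.mem_support_iff]
  refine and_congr_right fun hx => ?_
  constructor
  · intro h; linarith
  · intro h; rcases lt_or_gt_of_ne hx with h1 | h1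
    · linarith
    · exact absurd h1 h

lemma Represents.apply_mul_self {L : ℝ[X] →ₗ[ℝ] ℝ} {f : Option ℝ →₀ ℝ} (hf : Represents L f)
    {q : ℝ[X]} (hq : q.natDegree ≤ 3) :
    L (q * q) = ∑ x ∈ f.support, f x * pointEval 3 x q ^ 2 := by
  rw [hf _ (natDegree_mul_le_add hq hq)]
  refine Finset.sum_congr rfl fun x _ => ?_
  rw [sq, ← pointEval_mul hq hq]

/-- A representation with at most four points has the least possible number of positive weights. -/
lemma Represents.numPos_le_numPos {L : ℝ[X] →ₗ[ℝ] ℝ} {f g : Option ℝ →₀ ℝ}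
    (hf : Represents L f) (hg : Represents L g) (hcard : f.support.card ≤ 4) :
    numPos f ≤ numPos g := by
  classical
  by_contra! hlt
  set P := f.support.filter fun x => 0 < f x with hP
  set N := (-f).support.filter fun x => 0 < (-f) x with hN
  set G := g.support.filter fun x => 0 < g x with hG
  have hPN : P.card + N.card ≤ 4 := (numPos_neg_add f).trans_le hcard
  have hGP : G.card < P.card := hlt
  obtain ⟨x, hxP, hxG⟩ := Finset.exists_mem_notMem_of_card_lt_card hGP
  have hx : x ∉ G ∪ N := by
    rw [Finset.mem_union, not_or]
    refine ⟨hxG, fun h => ?_⟩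
    have h1 := (Finset.mem_filter.1 hxP).2
    have h2 := (Finset.mem_filter.1 h).2
    rw [Finsupp.neg_apply] at h2
    linarith
  -- Since |G| < |P| and |P| + |N| ≤ 4, the set G ∪ N has at most three points. The resulting cubic
  -- kills the negative part of `f` and the positive part of `g`, so L(q²) gets contradictory signs.
  obtain ⟨q, hq, hT, hqx⟩ := exists_pointEval_eq_zero_of_card_le (G ∪ N) hx (d := 3)
    ((Finset.card_union_le _ _).trans (by omega))
  have h1 : 0 < L (q * q) := by
    rw [hf.apply_mul_self hq]
    refine Finset.sum_pos' (fun y hy => ?_) ⟨x, (Finset.mem_filter.1 hxP).1, ?_⟩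
    · rcases le_or_gt 0 (f y) with h | h
      · positivity
      · rw [hT y (Finset.mem_union_right _ (Finset.mem_filter.2 ⟨by simpa using h.ne, by simpa⟩))]
        simp
    · have := (Finset.mem_filter.1 hxP).2
      positivity
  have h2 : L (q * q) ≤ 0 := by
    rw [hg.apply_mul_self hq]
    refine Finset.sum_nonpos fun y hy => ?_
    rcases le_or_gt (g y) 0 with h | h
    · exact mul_nonpos_of_nonpos_of_nonneg h (sq_nonneg _)
    · rw [hT y (Finset.mem_union_left _ (Finset.mem_filter.2 ⟨hy, h⟩))]
      simp
  linarith

/-- A functional that annihilates the ideal of `T` is a combination of evaluations at `T`. -/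
lemma exists_represents_of_vanishing {L : ℝ[X] →ₗ[ℝ] ℝ} (T : Finset (Option ℝ))
    (hT : T.card ≤ 7)
    (h0 : ∀ h : ℝ[X], h.natDegree ≤ 6 → (∀ x ∈ T, pointEval 6 x h = 0) → L h = 0) :
    ∃ f : Option ℝ →₀ ℝ, Represents L f ∧ f.support ⊆ T := by
  classical
  -- Lagrange interpolants: with at most seven nodes, degree six suffices.
  have hq : ∀ x : Option ℝ, ∃ q : ℝ[X], x ∈ T → q.natDegree ≤ 6 ∧
      (∀ y ∈ T, pointEval 6 y q = if y = x then 1 else 0) := by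
    intro x
    by_cases hx : x ∈ T
    · obtain ⟨q, hq, hy, hqx⟩ := exists_pointEval_eq_zero_of_card_le (T.erase x)
        (Finset.notMem_erase x T) (d := 6) (by rw [Finset.card_erase_of_mem hx]; omega)
      refine ⟨(pointEval 6 x q)⁻¹ • q, fun _ => ⟨(natDegree_smul_le _ _).trans hq, ?_⟩⟩
      intro y hyT
      rw [map_smul, smul_eq_mul]
      split_ifs with h
      · rw [h, inv_mul_cancel₀ hqx]
      · rw [hy y (Finset.mem_erase.2 ⟨h, hyT⟩), mul_zero]
    · exact ⟨0, fun h => absurd h hx⟩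
  choose q hq using hq
  refine ⟨Finsupp.onFinset T (fun x => if x ∈ T then L (q x) else 0) (by intro x; simp; tauto), ?_,
    Finsupp.support_onFinset_subset⟩
  intro h hh
  rw [Finsupp.onFinset_sum _ (by intros; ring)]
  have key := h0 (h - ∑ x ∈ T, pointEval 6 x h • q x) ?_ ?_
  · rw [map_sub, map_sum, sub_eq_zero] at key
    rw [key]
    refine Finset.sum_congr rfl fun x hx => ?_
    rw [if_pos hx, map_smul, smul_eq_mul, mul_comm]
  · refine (natDegree_sub_le _ _).trans (max_le hh ?_)
    exact natDegree_sum_le_of_forall_le _ _ fun x hx =>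
      (natDegree_smul_le _ _).trans (hq x hx).1
  · intro y hy
    rw [map_sub, map_sum, sub_eq_zero]
    rw [Finset.sum_eq_single y]
    · rw [map_smul, (hq y hy).2 y hy]; simp
    · intro x hx hxy
      rw [map_smul, (hq x hx).2 y hy, if_neg hxy.symm]; simp
    · exact fun h => absurd hy h

/-- Seven points represent every functional. -/
lemma exists_represents_card_le_seven (L : ℝ[X] →ₗ[ℝ] ℝ) :
    ∃ f : Option ℝ →₀ ℝ, Represents L f ∧ f.support.card ≤ 7 := by
  obtain ⟨T, hT⟩ := Infinite.exists_subset_card_eq (Option ℝ) 7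
  obtain ⟨f, hf, hfT⟩ := exists_represents_of_vanishing (L := L) T hT.le fun h hh hv => by
    obtain ⟨x, hx⟩ := Finset.card_pos.1 (hT ▸ Nat.succ_pos 6 : 0 < T.card)
    classical
    have hc : (T.erase x).card = 6 := by rw [Finset.card_erase_of_mem hx, hT]
    -- Six zeros determine the sextic up to a constant, and the product is nonzero at the seventh
    -- point.
    obtain ⟨g, hg, rfl⟩ := exists_eq_prod_vanishing_mul (T.erase x) (d := 0) (f := h)
      (by rw [hc]; exact hh) (by rw [hc]; exact fun y hy => hv y (Finset.mem_of_mem_erase hy))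
    obtain ⟨c, rfl⟩ := natDegree_eq_zero.1 (Nat.le_zero.1 hg)
    have hv := hv x hx
    obtain rfl | hc0 := eq_or_ne c 0
    · simp
    exfalso
    have hne : ∀ S : Finset (Option ℝ), x ∉ S → (∏ y ∈ S, vanishing y).natDegree ≤ S.card ∧
        pointEval S.card x (∏ y ∈ S, vanishing y) ≠ 0 := by
      intro S
      induction S using Finset.induction_on with
      | empty => intro _; cases x <;> simp
      | insert a S ha ih =>
        intro hxS
        rw [Finset.mem_insert, not_or] at hxS
        obtain ⟨h1, h2⟩ := ih hxS.2
        rw [Finset.prod_insert ha, Finset.card_insert_of_notMem ha, add_comm]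
        refine ⟨natDegree_mul_le_add (natDegree_vanishing_le a) h1, ?_⟩
        rw [pointEval_mul (natDegree_vanishing_le a) h1]
        exact mul_ne_zero (pointEval_vanishing_ne_zero (Ne.symm hxS.1)) h2
    obtain ⟨-, h2⟩ := hne (T.erase x) (Finset.notMem_erase x T)
    rw [hc] at h2
    rw [mul_comm, ← smul_eq_C_mul, map_smul, smul_eq_mul] at hv
    exact (mul_ne_zero hc0 h2) hv
  exact ⟨f, hf, (Finset.card_le_card hfT).trans hT.le⟩

/-! ### Functionals nonnegative on squares of cubics -/

/-- Cauchy–Schwarz, from the discriminant of t ↦ L((tq + r)²). -/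
lemma NonnegOnSquares.sq_apply_mul_le {L : ℝ[X] →ₗ[ℝ] ℝ} (hL : NonnegOnSquares L) {q r : ℝ[X]}
    (hq : q.natDegree ≤ 3) (hr : r.natDegree ≤ 3) :
    L (q * r) ^ 2 ≤ L (q * q) * L (r * r) := by
  have h := discrim_le_zero (a := L (q * q)) (b := 2 * L (q * r)) (c := L (r * r)) fun t => by
    have h1 := hL (C t * q + r) ((natDegree_add_le _ _).trans
      (max_le ((natDegree_C_mul_le _ _).trans hq) hr))
    have h2 : (C t * q + r) * (C t * q + r) =
        (t * t) • (q * q) + (2 * t) • (q * r) + r * r := by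
      simp only [smul_eq_C_mul, C_mul, map_ofNat]
      ring
    rw [h2, map_add, map_add, map_smul, map_smul, smul_eq_mul, smul_eq_mul] at h1
    linarith
  rw [discrim] at h
  linarith

lemma NonnegOnSquares.apply_mul_eq_zero {L : ℝ[X] →ₗ[ℝ] ℝ} (hL : NonnegOnSquares L) {q : ℝ[X]}
    (hq : q.natDegree ≤ 3) (h0 : L (q * q) = 0) {r : ℝ[X]} (hr : r.natDegree ≤ 3) :
    L (q * r) = 0 := by
  have h := hL.sq_apply_mul_le hq hr
  rw [h0, zero_mul] at h
  exact pow_eq_zero_iff two_ne_zero |>.1 (le_antisymm h (sq_nonneg _))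

/-- Subtracting the largest possible multiple of a point evaluation makes a nonnegative
functional singular. -/
lemma NonnegOnSquares.exists_sub_smul_pointEval {L : ℝ[X] →ₗ[ℝ] ℝ} (hL : NonnegOnSquares L)
    (x : Option ℝ) : ∃ c : ℝ, NonnegOnSquares (L - c • pointEval 6 x) ∧
      ∃ w : ℝ[X], w.natDegree ≤ 3 ∧ w ≠ 0 ∧
        ∀ r : ℝ[X], r.natDegree ≤ 3 → (L - c • pointEval 6 x) (w * r) = 0 := by
  have hmem : ∀ q : ℝ[X], q ∈ degreeLT ℝ 4 ↔ q.natDegree ≤ 3 := by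
    intro q
    rw [mem_degreeLT, degree_lt_iff_coeff_zero, natDegree_le_iff_coeff_eq_zero]
    rfl
  have hev : ∀ (c : ℝ) {q r : ℝ[X]}, q.natDegree ≤ 3 → r.natDegree ≤ 3 →
      (L - c • pointEval 6 x) (q * r) = L (q * r) - c * (pointEval 3 x q * pointEval 3 x r) := by
    intro c q r hq hr
    rw [← pointEval_mul hq hr]
    rfl
  obtain ⟨q₀, hq₀, -, hxq₀⟩ := exists_pointEval_eq_zero_of_card_le ∅ (x := x) (by simp) (d := 3)
    (by simp)
  let V := degreeLT ℝ 4
  let B : V →ₗ[ℝ] Module.Dual ℝ V := ((LinearMap.mul ℝ ℝ[X]).compr₂ L).domRestrict₁₂ V V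
  let e : Module.Dual ℝ V := (pointEval 3 x).comp V.subtype
  have hB : ∀ q r : V, B q r = L (q.1 * r.1) := fun _ _ => rfl
  have he : ∀ q : V, e q = pointEval 3 x q.1 := fun _ => rfl
  -- If evaluation at `x` is q ↦ L(wq), Cauchy–Schwarz allows subtracting 1/L(w²) times it, and `w`
  -- enters the kernel. Otherwise duality gives a kernel vector of `B` on which evaluation is
  -- nonzero: `L` is already singular and c = 0.
  by_cases h : e ∈ LinearMap.range B
  · obtain ⟨w, hw⟩ := h
    have hwr : ∀ {r : ℝ[X]}, r.natDegree ≤ 3 → L (w.1 * r) = pointEval 3 x r := by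
      intro r hr
      exact LinearMap.congr_fun hw ⟨r, (hmem r).2 hr⟩
    have hwd := (hmem _).1 w.2
    have hww : 0 < L (w.1 * w.1) := by
      refine lt_of_le_of_ne (hL _ hwd) fun h0 => hxq₀ ?_
      rw [← hwr hq₀]
      exact hL.apply_mul_eq_zero hwd h0.symm hq₀
    refine ⟨(L (w.1 * w.1))⁻¹, fun q hq => ?_, w.1, hwd, ?_, fun r hr => ?_⟩
    · rw [hev _ hq hq, ← hwr hq, sub_nonneg, inv_mul_le_iff₀ hww, ← sq]
      exact hL.sq_apply_mul_le hwd hq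
    · intro h0
      simp [h0] at hww
    · rw [hev _ hwd hr, ← hwr hwd, inv_mul_cancel_left₀ hww.ne', hwr hr, sub_self]
  · obtain ⟨φ, hφ, hker⟩ := Submodule.exists_le_ker_of_notMem h
    obtain ⟨w, rfl⟩ := (Module.evalEquiv ℝ V).surjective φ
    have hwd := (hmem _).1 w.2
    refine ⟨0, by simpa using hL, w.1, hwd, ?_, fun r hr => ?_⟩
    · intro h0
      refine hφ (show e w = 0 from ?_)
      rw [he, h0, map_zero]
    · have h1 : B ⟨r, (hmem r).2 hr⟩ w = 0 := hker ⟨_, rfl⟩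
      rw [hB] at h1
      rw [zero_smul, sub_zero, mul_comm]
      exact h1

lemma exists_pointEval_three_eq_zero (q : ℝ[X]) (hq : q.natDegree ≤ 3) :
    ∃ x, pointEval 3 x q = 0 := by
  by_cases h3 : q.coeff 3 = 0
  · exact ⟨none, h3⟩
  have hd : q.natDegree = 3 := le_antisymm hq (le_natDegree_of_ne_zero h3)
  have hq0 : q ≠ 0 := by rintro rfl; simp at h3
  have hred : ¬ Irreducible q := fun h => by have := h.natDegree_le_two; omega
  obtain ⟨f, hf, hdvd⟩ : ∃ f : ℝ[X], f.natDegree = 1 ∧ f ∣ q := by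
    rw [irreducible_iff] at hred
    push Not at hred
    obtain ⟨a, b, hab, ha, hb⟩ := hred (fun h => by
      have := natDegree_eq_zero_of_isUnit h; omega)
    have ha0 : a ≠ 0 := by rintro rfl; simp at hab; exact hq0 hab
    have hb0 : b ≠ 0 := by rintro rfl; simp at hab; exact hq0 hab
    have hsum : a.natDegree + b.natDegree = 3 := by rw [← natDegree_mul ha0 hb0, ← hab, hd]
    have ha1 : a.natDegree ≠ 0 := fun h => ha (by
      obtain ⟨c, rfl⟩ := natDegree_eq_zero.1 h
      exact isUnit_C.2 (isUnit_iff_ne_zero.2 (by rintro rfl; simp at ha0)))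
    have hb1 : b.natDegree ≠ 0 := fun h => hb (by
      obtain ⟨c, rfl⟩ := natDegree_eq_zero.1 h
      exact isUnit_C.2 (isUnit_iff_ne_zero.2 (by rintro rfl; simp at hb0)))
    rcases (by omega : a.natDegree = 1 ∨ b.natDegree = 1) with h | h
    · exact ⟨a, h, hab ▸ dvd_mul_right a b⟩
    · exact ⟨b, h, hab ▸ dvd_mul_left b a⟩
  obtain ⟨s, hs⟩ := exists_root_of_degree_eq_one (degree_eq_iff_natDegree_eq_of_pos one_pos |>.2 hf)
  exact ⟨some s, hs.dvd hdvd⟩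

lemma exists_pointEval_one_eq_zero (q : ℝ[X]) (hq : q.natDegree ≤ 1) :
    ∃ x, pointEval 1 x q = 0 := by
  by_cases h1 : q.coeff 1 = 0
  · exact ⟨none, h1⟩
  · obtain ⟨s, hs⟩ := exists_root_of_degree_eq_one (p := q)
      (degree_eq_iff_natDegree_eq_of_pos one_pos |>.2
        (le_antisymm hq (le_natDegree_of_ne_zero h1)))
    exact ⟨some s, hs⟩

lemma exists_root_or_eq_sum_sq (u : ℝ[X]) (hu : u.natDegree ≤ 2) :
    (∃ x, pointEval 2 x u = 0) ∨
      ∃ a b δ : ℝ, a ≠ 0 ∧ 0 < δ ∧ u = C a * ((X - C b) * (X - C b) + C δ) := by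
  by_cases h2 : u.coeff 2 = 0
  · exact Or.inl ⟨none, h2⟩
  have hu' := u.as_sum_range' 3 (by omega)
  simp only [Finset.sum_range_succ, Finset.sum_range_zero, ← C_mul_X_pow_eq_monomial, zero_add]
    at hu'
  by_cases hd : 0 ≤ discrim (u.coeff 2) (u.coeff 1) (u.coeff 0)
  · obtain ⟨s, hs⟩ := exists_quadratic_eq_zero h2 ⟨_, (Real.mul_self_sqrt hd).symm⟩
    refine Or.inl ⟨some s, ?_⟩
    rw [pointEval_some, hu']
    simp only [eval_add, eval_mul, eval_C, eval_pow, eval_X]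
    linarith
  · right
    rw [discrim] at hd
    refine ⟨u.coeff 2, -(u.coeff 1 / (2 * u.coeff 2)),
      (4 * u.coeff 2 * u.coeff 0 - u.coeff 1 ^ 2) / (4 * u.coeff 2 ^ 2), h2, ?_, ?_⟩
    · apply div_pos
      · linarith
      · positivity
    · nth_rewrite 1 [hu']
      generalize u.coeff 2 = a at *
      generalize u.coeff 1 = b at *
      generalize u.coeff 0 = c at *
      have e : C a * ((X - C (-(b / (2 * a)))) * (X - C (-(b / (2 * a))))
          + C ((4 * a * c - b ^ 2) / (4 * a ^ 2))) =
          C a * X ^ 2 + C (a * (2 * (b / (2 * a)))) * X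
          + C (a * ((b / (2 * a)) ^ 2 + (4 * a * c - b ^ 2) / (4 * a ^ 2))) := by
        simp only [C_mul, C_add, C_neg, C_pow, map_ofNat]
        ring
      rw [e, show a * (2 * (b / (2 * a))) = b by field_simp,
        show a * ((b / (2 * a)) ^ 2 + (4 * a * c - b ^ 2) / (4 * a ^ 2)) = c by field_simp; ring]
      ring

/-- The functional annihilates all multiples of a cubic. -/
def Annihilates (L : ℝ[X] →ₗ[ℝ] ℝ) (q : ℝ[X]) : Prop :=
  ∀ r : ℝ[X], r.natDegree ≤ 3 → L (q * r) = 0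

lemma natDegree_vanishing_three_le (x y z : Option ℝ) :
    (vanishing x * vanishing y * vanishing z).natDegree ≤ 3 :=
  natDegree_mul_le_add (d := 2) (natDegree_mul_le_add (natDegree_vanishing_le x)
    (natDegree_vanishing_le y)) (natDegree_vanishing_le z)

/-- Writing points for their linear forms, (xzw)² = (x²z)(zw²), so L kills the square of xzw and
hence its multiples. The free choice of `w` removes repeated roots. -/
lemma NonnegOnSquares.annihilates_of_double {L : ℝ[X] →ₗ[ℝ] ℝ} (hL : NonnegOnSquares L)
    {x z : Option ℝ} (h : Annihilates L (vanishing x * vanishing x * vanishing z))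
    (w : Option ℝ) : Annihilates L (vanishing x * vanishing z * vanishing w) := by
  intro r hr
  refine hL.apply_mul_eq_zero (natDegree_vanishing_three_le x z w) ?_ hr
  have := h (vanishing z * vanishing w * vanishing w) (natDegree_vanishing_three_le z w w)
  rw [← this]
  congr 1
  ring

/-- A singular nonnegative functional annihilates a cubic with three distinct real roots. -/
lemma NonnegOnSquares.exists_annihilates_vanishing {L : ℝ[X] →ₗ[ℝ] ℝ} (hL : NonnegOnSquares L)
    {q : ℝ[X]} (hq : q.natDegree ≤ 3) (hq0 : q ≠ 0) (hLq : Annihilates L q) :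
    ∃ x y z : Option ℝ, x ≠ y ∧ x ≠ z ∧ y ≠ z ∧
      Annihilates L (vanishing x * vanishing y * vanishing z) := by
  have hdouble : ∀ x z : Option ℝ, Annihilates L (vanishing x * vanishing x * vanishing z) →
      ∃ x y z : Option ℝ, x ≠ y ∧ x ≠ z ∧ y ≠ z ∧
        Annihilates L (vanishing x * vanishing y * vanishing z) := by
    have hne : ∀ x z : Option ℝ, x ≠ z → Annihilates L (vanishing x * vanishing x * vanishing z) →
        ∃ x y z : Option ℝ, x ≠ y ∧ x ≠ z ∧ y ≠ z ∧
          Annihilates L (vanishing x * vanishing y * vanishing z) := by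
      intro x z hxz h
      obtain ⟨w, hw⟩ := Infinite.exists_notMem_finset ({x, z} : Finset (Option ℝ))
      simp only [Finset.mem_insert, Finset.mem_singleton, not_or] at hw
      exact ⟨x, z, w, hxz, Ne.symm hw.1, Ne.symm hw.2, hL.annihilates_of_double h w⟩
    intro x z h
    by_cases hxz : x = z
    · subst hxz
      obtain ⟨w, hw⟩ := exists_ne x
      exact hne x w hw.symm (hL.annihilates_of_double h w)
    · exact hne x z hxz h
  obtain ⟨x, hx⟩ := exists_pointEval_three_eq_zero q hq
  obtain ⟨u, hu, rfl⟩ := exists_eq_vanishing_mul hq hx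
  rcases exists_root_or_eq_sum_sq u hu with ⟨y, hy⟩ | ⟨a, b, δ, ha, hδ, rfl⟩
  · obtain ⟨v, hv, rfl⟩ := exists_eq_vanishing_mul hu hy
    obtain ⟨z, hz⟩ := exists_pointEval_one_eq_zero v hv
    obtain ⟨k, hk, rfl⟩ := exists_eq_vanishing_mul (d := 0) hv hz
    obtain ⟨c, rfl⟩ := natDegree_eq_zero.1 (Nat.le_zero.1 hk)
    have hc : c ≠ 0 := by rintro rfl; simp at hq0
    have hxyz : Annihilates L (vanishing x * vanishing y * vanishing z) := by
      intro r hr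
      have h1 := hLq r hr
      have h2 : vanishing x * (vanishing y * (vanishing z * C c)) * r =
          c • (vanishing x * vanishing y * vanishing z * r) := by
        rw [smul_eq_C_mul]; ring
      rw [h2, map_smul, smul_eq_mul] at h1
      exact (mul_eq_zero.1 h1).resolve_left hc
    by_cases hxy : x = y
    · subst hxy; exact hdouble _ _ hxyz
    by_cases hxz : x = z
    · subst hxz; exact hdouble x y (by rwa [mul_right_comm] at hxyz)
    by_cases hyz : y = z
    · subst hyz; exact hdouble y x (by rwa [mul_assoc, mul_comm] at hxyz)
    exact ⟨x, y, z, hxy, hxz, hyz, hxyz⟩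
  -- The quadratic factor is a(ℓ² + δm²), where ℓ vanishes at `b` and m = 1 at infinity. Testing
  -- against xw² gives two nonnegative terms with sum zero, so both vanish; `w` is a free third
  -- root.
  · have key : ∀ w : Option ℝ,
        Annihilates L (vanishing x * vanishing (some b) * vanishing w) ∧
        Annihilates L (vanishing x * vanishing none * vanishing w) := by
      intro w
      have h1 := hLq _ (natDegree_vanishing_three_le x w w)
      have h2 : vanishing x * (C a * ((X - C b) * (X - C b) + C δ)) *
          (vanishing x * vanishing w * vanishing w) =
          a • ((vanishing x * vanishing (some b) * vanishing w) *
              (vanishing x * vanishing (some b) * vanishing w) +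
            δ • ((vanishing x * vanishing none * vanishing w) *
              (vanishing x * vanishing none * vanishing w))) := by
        simp only [smul_eq_C_mul, vanishing]
        ring
      rw [h2, map_smul, map_add, map_smul, smul_eq_mul, smul_eq_mul] at h1
      replace h1 := (mul_eq_zero.1 h1).resolve_left ha
      have h3 := hL _ (natDegree_vanishing_three_le x (some b) w)
      have h4 := hL _ (natDegree_vanishing_three_le x none w)
      have h5 := mul_nonneg hδ.le h4
      refine ⟨fun r hr => hL.apply_mul_eq_zero (natDegree_vanishing_three_le _ _ _) ?_ hr,
        fun r hr => hL.apply_mul_eq_zero (natDegree_vanishing_three_le _ _ _) ?_ hr⟩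
      · linarith
      · have : δ * L ((vanishing x * vanishing none * vanishing w) *
          (vanishing x * vanishing none * vanishing w)) = 0 := by linarith
        exact (mul_eq_zero.1 this).resolve_left hδ.ne'
    cases x with
    | none => exact ⟨none, some b, some (b + 1), by simp, by simp, by simp, (key _).1⟩
    | some s => exact ⟨some s, none, some (s + 1), by simp, by simp, by simp, (key _).2⟩

/-- A singular nonnegative functional is a nonnegative combination of at most three
point evaluations. -/
lemma NonnegOnSquares.exists_represents {L : ℝ[X] →ₗ[ℝ] ℝ} (hL : NonnegOnSquares L)
    {q : ℝ[X]} (hq : q.natDegree ≤ 3) (hq0 : q ≠ 0) (hLq : Annihilates L q) :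
    ∃ f : Option ℝ →₀ ℝ, Represents L f ∧ f.support.card ≤ 3 ∧ ∀ x, 0 ≤ f x := by
  classical
  obtain ⟨x, y, z, hxy, hxz, hyz, h⟩ := hL.exists_annihilates_vanishing hq hq0 hLq
  have hcard : ({x, y, z} : Finset (Option ℝ)).card = 3 := Finset.card_eq_three.2
    ⟨x, y, z, hxy, hxz, hyz, rfl⟩
  obtain ⟨f, hf, hfs⟩ := exists_represents_of_vanishing (L := L) {x, y, z} (by omega)
    fun g hg hg0 => by
      obtain ⟨k, hk, rfl⟩ := exists_eq_prod_vanishing_mul {x, y, z} (d := 3) (f := g)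
        (by rw [hcard]; exact hg) (by rw [hcard]; exact hg0)
      rw [Finset.prod_insert (by simp [hxy, hxz]), Finset.prod_insert (by simp [hyz]),
        Finset.prod_singleton, ← mul_assoc (vanishing x)]
      exact h k hk
  refine ⟨f, hf, (Finset.card_le_card hfs).trans hcard.le, fun t => ?_⟩
  by_contra! hlt
  have ht : t ∈ f.support := Finsupp.mem_support_iff.2 hlt.ne
  -- A cubic vanishing at the other points, at most two, isolates the sign of the weight at `t`.
  obtain ⟨r, hr, hr0, hrt⟩ := exists_pointEval_eq_zero_of_card_le (f.support.erase t)
    (Finset.notMem_erase t _) (d := 3) (by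
      have := Finset.card_le_card ((Finset.erase_subset t _).trans hfs)
      omega)
  have h1 := hL r hr
  rw [hf.apply_mul_self hr, Finset.sum_eq_single t
    (fun s hs hst => by rw [hr0 s (Finset.mem_erase.2 ⟨hst, hs⟩)]; ring)
    (fun h => absurd ht h)] at h1
  have : 0 < pointEval 3 t r ^ 2 := by positivity
  nlinarith

/-! ### Reducing the number of weights of one sign -/

lemma Represents.nonnegOnSquares {L : ℝ[X] →ₗ[ℝ] ℝ} {f : Option ℝ →₀ ℝ} (hf : Represents L f)
    (h : ∀ x, 0 ≤ f x) : NonnegOnSquares L := by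
  intro q hq
  rw [hf.apply_mul_self hq]
  exact Finset.sum_nonneg fun x _ => mul_nonneg (h x) (sq_nonneg _)

lemma NonnegOnSquares.exists_represents_sub {L : ℝ[X] →ₗ[ℝ] ℝ} (hL : NonnegOnSquares L)
    (x : Option ℝ) : ∃ (c : ℝ) (f : Option ℝ →₀ ℝ), Represents L (f + Finsupp.single x c) ∧
      f.support.card ≤ 3 ∧ ∀ y, 0 ≤ f y := by
  obtain ⟨c, hc, w, hw, hw0, hLw⟩ := hL.exists_sub_smul_pointEval x
  obtain ⟨f, hf, hcard, h0⟩ := hc.exists_represents hw hw0 hLw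
  refine ⟨c, f, ?_, hcard, h0⟩
  have := hf.add (represents_single x c)
  rwa [sub_add_cancel] at this

lemma numPos_eq_zero {f : Option ℝ →₀ ℝ} (h : numPos f = 0) (x : Option ℝ) : f x ≤ 0 := by
  classical
  by_contra! hx
  rw [numPos, Finset.card_eq_zero] at h
  exact Finset.notMem_empty x (h ▸ Finset.mem_filter.2 ⟨Finsupp.mem_support_iff.2 hx.ne', hx⟩)

/-- The number of negative weights can be reduced to at most three without increasing the
number of positive ones, unless there is a representation by at most four points. -/
lemma Represents.exists_numPos_le {L : ℝ[X] →ₗ[ℝ] ℝ} : ∀ (k : ℕ) {f : Option ℝ →₀ ℝ},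
    Represents L f → numPos f = k →
    ∃ g : Option ℝ →₀ ℝ, Represents L g ∧
      (numPos g ≤ k ∧ numPos (-g) ≤ 3 ∨ g.support.card ≤ 4) := by
  classical
  intro k
  induction k using Nat.strong_induction_on with
  | _ k ih =>
  intro f hf hk
  rcases Nat.eq_zero_or_pos k with rfl | hpos
  -- Now `-L` is nonnegative on squares; splitting off an arbitrary point, here infinity, leaves at
  -- most 3 + 1 points.
  · obtain ⟨c, g, hg, hg3, -⟩ := (hf.neg.nonnegOnSquares fun x => by
      simpa using numPos_eq_zero hk x).exists_represents_sub none
    refine ⟨-(g + Finsupp.single none c), by simpa using hg.neg, Or.inr ?_⟩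
    rw [Finsupp.support_neg]
    have h1 := (Finset.card_le_card (Finsupp.support_add (g₁ := g)
      (g₂ := Finsupp.single none c))).trans (Finset.card_union_le _ _)
    have h2 := Finset.card_le_card (Finsupp.support_single_subset (a := (none : Option ℝ)) (b := c))
    rw [Finset.card_singleton] at h2
    omega
  · obtain ⟨x, hx⟩ := Finset.card_pos.1 (hk ▸ hpos : 0 < numPos f)
    obtain ⟨hxs, hx0⟩ := Finset.mem_filter.1 hx
    let F : Option ℝ →₀ ℝ := f.filter fun y => 0 < f y
    have hF : ∀ y, F y = if 0 < f y then f y else 0 := fun y => Finsupp.filter_apply _ _ _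
    have hFM : Represents (Finsupp.linearCombination ℝ (pointEval 6) F) F := by
      intro h _
      rw [Finsupp.linearCombination_apply, Finsupp.sum, LinearMap.sum_apply, Finsupp.sum]
      rfl
    -- `F - f` is the negative part with its sign changed. Splitting it at a positive point of `f`
    -- lets the extra term be absorbed by the weight there.
    obtain ⟨c, g, hg, hg3, hg0⟩ := ((hf.neg.add hFM).nonnegOnSquares fun y => by
      rw [Finsupp.add_apply, Finsupp.neg_apply, hF]
      split_ifs <;> linarith).exists_represents_sub x
    let G : Option ℝ →₀ ℝ := F - Finsupp.single x c - g
    have hG : Represents L G := by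
      have h1 := hFM.add hg.neg
      rw [neg_add, neg_neg, add_left_comm, add_neg_cancel, add_zero] at h1
      convert h1 using 1
      simp only [G]
      abel
    have hGy : ∀ y, y ≠ x → G y = F y - g y := by
      intro y hy
      simp [G, hy.symm]
    have hGx : G x = f x - c - g x := by simp [G, hF, hx0]
    have hGpos : (G.support.filter fun y => 0 < G y) ⊆
        insert x (f.support.filter fun y => 0 < f y) := by
      intro y hy
      rw [Finset.mem_insert]
      by_cases hyx : y = x
      · exact Or.inl hyx
      right
      have h1 := (Finset.mem_filter.1 hy).2
      rw [hGy y hyx, hF] at h1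
      have h2 := hg0 y
      have h3 : 0 < f y := by
        by_contra h3
        rw [if_neg h3] at h1
        linarith
      exact Finset.mem_filter.2 ⟨Finsupp.mem_support_iff.2 h3.ne', h3⟩
    rw [Finset.insert_eq_of_mem hx] at hGpos
    have hGneg : ((-G).support.filter fun y => 0 < (-G) y) ⊆ insert x g.support := by
      intro y hy
      rw [Finset.mem_insert]
      by_cases hyx : y = x
      · exact Or.inl hyx
      right
      have h1 := (Finset.mem_filter.1 hy).2
      rw [Finsupp.neg_apply, hGy y hyx, hF] at h1
      rw [Finsupp.mem_support_iff]
      intro h2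
      rw [h2] at h1
      split_ifs at h1 <;> linarith
    -- Only the weight at `x` can escape control. If it stays nonnegative, all negative points lie
    -- in the support of `g`; if not, a positive point is lost and induction applies.
    by_cases hGx0 : 0 ≤ G x
    · refine ⟨G, hG, Or.inl ⟨hk ▸ Finset.card_le_card hGpos, ?_⟩⟩
      refine (Finset.card_le_card fun y hy => ?_).trans hg3
      refine (Finset.mem_insert.1 (hGneg hy)).resolve_left ?_
      rintro rfl
      have := (Finset.mem_filter.1 hy).2
      rw [Finsupp.neg_apply] at this
      linarith
    · have hlt : numPos G < k := hk ▸ Finset.card_lt_card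
        ⟨hGpos, fun h => hGx0 (Finset.mem_filter.1 (h hx)).2.le⟩
      obtain ⟨g', hg', h⟩ := ih _ hlt hG rfl
      exact ⟨g', hg', h.imp_left fun h => ⟨h.1.trans hlt.le, h.2⟩⟩

/-! ### Combinatorics of the badges -/

/-- If no badge of a functional is the least one, the badges include `(2, 3)` and `(3, 2)`, and
all badges are bounded below by one of these. -/
lemma minimal_badges_of_forall_not_isLeast {L : ℝ[X] →ₗ[ℝ] ℝ} {B : Set (ℕ × ℕ)}
    (hB : ∀ ab, ab ∈ B ↔ ∃ f, Represents L f ∧ numPos f = ab.1 ∧ numPos (-f) = ab.2)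
    (hl : ∀ ab, ¬ IsLeast B ab) :
    {ab | Minimal (· ∈ B) ab} = {(2, 3), (3, 2)} := by
  have hcard : ∀ f, Represents L f → 5 ≤ f.support.card := by
    intro f hf
    by_contra! h
    refine hl (numPos f, numPos (-f)) ⟨(hB _).2 ⟨f, hf, rfl, rfl⟩, ?_⟩
    rintro ⟨a, b⟩ hab
    obtain ⟨g, hg, rfl, rfl⟩ := (hB _).1 hab
    exact ⟨hf.numPos_le_numPos hg (by omega),
      hf.neg.numPos_le_numPos hg.neg (by rw [Finsupp.support_neg]; omega)⟩
  have hpos : ∀ f, Represents L f → ∃ g, Represents L g ∧ numPos g ≤ numPos f ∧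
      numPos (-g) ≤ 3 ∧ 2 ≤ numPos g := by
    intro f hf
    obtain ⟨g, hg, h⟩ := Represents.exists_numPos_le _ hf rfl
    have h5 := hcard g hg
    have := numPos_neg_add g
    exact ⟨g, hg, by omega, by omega, by omega⟩
  have hneg : ∀ f, Represents L f → ∃ g, Represents L g ∧ numPos g ≤ 3 ∧
      numPos (-g) ≤ numPos (-f) ∧ 2 ≤ numPos (-g) := by
    intro f hf
    obtain ⟨g, hg, h⟩ := Represents.exists_numPos_le _ hf.neg rfl
    have h5 := hcard (-g) (by simpa using hg.neg)
    rw [Finsupp.support_neg] at h5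
    have := numPos_neg_add g
    refine ⟨-g, by simpa using hg.neg, ?_⟩
    rw [neg_neg]
    exact ⟨by omega, by omega, by omega⟩
  have hge : ∀ f, Represents L f → 2 ≤ numPos f ∧ 2 ≤ numPos (-f) ∧
      5 ≤ numPos f + numPos (-f) := by
    intro f hf
    obtain ⟨g, -, h1, -, h2⟩ := hpos f hf
    obtain ⟨g', -, -, h3, h4⟩ := hneg f hf
    have := hcard f hf
    rw [← numPos_neg_add f] at this
    exact ⟨by omega, by omega, this⟩
  have h23 : (∃ f, Represents L f ∧ numPos f ≤ 2) → ((2, 3) : ℕ × ℕ) ∈ B := by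
    rintro ⟨f, hf, h2⟩
    obtain ⟨g, hg, h⟩ := hpos f hf
    have := hge g hg
    exact (hB _).2 ⟨g, hg, by dsimp only; omega, by dsimp only; omega⟩
  have h32 : (∃ f, Represents L f ∧ numPos (-f) ≤ 2) → ((3, 2) : ℕ × ℕ) ∈ B := by
    rintro ⟨f, hf, h2⟩
    obtain ⟨g, hg, h⟩ := hneg f hf
    have := hge g hg
    exact (hB _).2 ⟨g, hg, by dsimp only; omega, by dsimp only; omega⟩
  -- Otherwise a least badge appears: (3,2) if some representation has at most two negative weights.
  -- If none has, it is (3,3), reached by reducing a representation with at most seven points, one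
  -- of whose sign counts is at most 3.
  have hp : ∃ f, Represents L f ∧ numPos f ≤ 2 := by
    by_contra! hp
    by_cases hn : ∃ f, Represents L f ∧ numPos (-f) ≤ 2
    · refine hl (3, 2) ⟨h32 hn, ?_⟩
      rintro ⟨a, b⟩ hab
      obtain ⟨g, hg, rfl, rfl⟩ := (hB _).1 hab
      exact ⟨hp g hg, (hge g hg).2.1⟩
    · push Not at hn
      obtain ⟨f, hf, h7⟩ := exists_represents_card_le_seven L
      rw [← numPos_neg_add f] at h7
      refine hl (3, 3) ⟨?_, ?_⟩
      · rcases (by omega : numPos f ≤ 3 ∨ numPos (-f) ≤ 3) with h | h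
        · obtain ⟨g, hg, h1⟩ := hpos f hf
          have := hp g hg
          have := hn g hg
          exact (hB _).2 ⟨g, hg, by dsimp only; omega, by dsimp only; omega⟩
        · obtain ⟨g, hg, h1⟩ := hneg f hf
          have := hp g hg
          have := hn g hg
          exact (hB _).2 ⟨g, hg, by dsimp only; omega, by dsimp only; omega⟩
      · rintro ⟨a, b⟩ hab
        obtain ⟨g, hg, rfl, rfl⟩ := (hB _).1 hab
        exact ⟨hp g hg, hn g hg⟩
  have hn : ∃ f, Represents L f ∧ numPos (-f) ≤ 2 := by
    by_contra! hn
    refine hl (2, 3) ⟨h23 hp, ?_⟩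
    rintro ⟨a, b⟩ hab
    obtain ⟨g, hg, rfl, rfl⟩ := (hB _).1 hab
    exact ⟨(hge g hg).1, hn g hg⟩
  have hge' : ∀ a b, (a, b) ∈ B → 2 ≤ a ∧ 2 ≤ b ∧ 5 ≤ a + b := by
    intro a b hab
    obtain ⟨g, hg, rfl, rfl⟩ := (hB _).1 hab
    exact hge g hg
  ext ⟨a, b⟩
  simp only [Set.mem_ofPred_eq, Set.mem_insert_iff, Set.mem_singleton_iff, Prod.mk.injEq]
  constructor
  · intro hm
    have h := hge' a b hm.prop
    by_cases ha : a = 2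
    · have := hm.le_of_le (h23 hp) ⟨by dsimp only; omega, by dsimp only; omega⟩
      have h2 := this.2
      dsimp only at h2
      omega
    · have := hm.le_of_le (h32 hn) ⟨by dsimp only; omega, by dsimp only; omega⟩
      have h1 := this.1
      have h2 := this.2
      dsimp only at h1 h2
      omega
  · rintro (⟨rfl, rfl⟩ | ⟨rfl, rfl⟩)
    · refine ⟨h23 hp, ?_⟩
      rintro ⟨c, d⟩ hcd ⟨h1, h2⟩
      have := hge' c d hcd
      dsimp only at h1 h2
      exact ⟨by dsimp only; omega, by dsimp only; omega⟩
    · refine ⟨h32 hn, ?_⟩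
      rintro ⟨c, d⟩ hcd ⟨h1, h2⟩
      have := hge' c d hcd
      dsimp only at h1 h2
      exact ⟨by dsimp only; omega, by dsimp only; omega⟩

/-! ### Apolarity: from sextics to functionals -/

/-- The vector representing a point of the projective line. -/
def pointVec : Option ℝ → Fin 2 → ℝ
  | some s => ![1, s]
  | none => ![0, 1]

/-- The exponent of `x ^ (6 - i) * y ^ i`. -/
noncomputable def sexticExp (i : ℕ) : Fin 2 →₀ ℕ := Finsupp.single 0 (6 - i) + Finsupp.single 1 i

/-- The functional on sextics apolar to a binary sextic. -/
noncomputable def apolarFunctional : MvPolynomial (Fin 2) ℝ →ₗ[ℝ] ℝ[X] →ₗ[ℝ] ℝ :=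
  ∑ i ∈ Finset.range 7, (MvPolynomial.lcoeff ℝ (sexticExp i)).smulRight
    ((Nat.choose 6 i : ℝ)⁻¹ • Polynomial.lcoeff ℝ i)

lemma apolarFunctional_apply (p : MvPolynomial (Fin 2) ℝ) (h : ℝ[X]) :
    apolarFunctional p h = ∑ i ∈ Finset.range 7,
      p.coeff (sexticExp i) * ((Nat.choose 6 i : ℝ)⁻¹ * h.coeff i) := by
  simp [apolarFunctional, LinearMap.sum_apply]

lemma sexticExp_injective : Function.Injective sexticExp := fun i j h => by
  simpa [sexticExp] using DFunLike.congr_fun h 1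

lemma coeff_linearForm_pow (α : Fin 2 → ℝ) {i : ℕ} (hi : i < 7) :
    (linearForm α ^ 6).coeff (sexticExp i) = Nat.choose 6 i * (α 0 ^ (6 - i) * α 1 ^ i) := by
  have h : linearForm α ^ 6 = ∑ i ∈ Finset.range 7,
      MvPolynomial.monomial (sexticExp i) (Nat.choose 6 i * (α 0 ^ (6 - i) * α 1 ^ i)) := by
    rw [linearForm, Fin.sum_univ_two, add_comm, add_pow]
    refine Finset.sum_congr rfl fun j _ => ?_
    rw [sexticExp, MvPolynomial.monomial_eq, Finsupp.prod_add_index' (by simp)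
      (by intros; ring), Finsupp.prod_single_index (by simp), Finsupp.prod_single_index (by simp)]
    simp only [MvPolynomial.C_mul, MvPolynomial.C_pow, map_natCast]
    ring
  rw [h, MvPolynomial.coeff_sum, Finset.sum_eq_single i]
  · rw [MvPolynomial.coeff_monomial, if_pos rfl]
  · intro j _ hj
    rw [MvPolynomial.coeff_monomial, if_neg (sexticExp_injective.ne hj)]
  · exact fun h => absurd (Finset.mem_range.2 hi) h

/-- The inverse binomial coefficients in `apolarFunctional` cancel those of the sixth power. -/
lemma apolarFunctional_linearForm_pow (x : Option ℝ) {h : ℝ[X]} (hh : h.natDegree ≤ 6) :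
    apolarFunctional (linearForm (pointVec x) ^ 6) h = pointEval 6 x h := by
  have h1 : apolarFunctional (linearForm (pointVec x) ^ 6) h =
      ∑ i ∈ Finset.range 7, pointVec x 0 ^ (6 - i) * pointVec x 1 ^ i * h.coeff i := by
    rw [apolarFunctional_apply]
    refine Finset.sum_congr rfl fun i hi => ?_
    have hi := Finset.mem_range.1 hi
    have : (Nat.choose 6 i : ℝ) ≠ 0 := by
      exact_mod_cast (Nat.choose_pos (by omega)).ne'
    rw [coeff_linearForm_pow _ hi]
    field_simp
  rw [h1]
  cases x with
  | none => simp [pointVec, Finset.sum_range_succ]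
  | some s =>
    rw [pointEval_some, eval_eq_sum_range' (n := 7) (by omega)]
    simp [pointVec, mul_comm]

lemma isHomogeneous_linearForm {n : ℕ} (α : Fin n → ℝ) : (linearForm α).IsHomogeneous 1 := by
  refine MvPolynomial.IsHomogeneous.sum _ _ _ fun i _ => ?_
  simpa using (MvPolynomial.isHomogeneous_C _ (α i)).mul (MvPolynomial.isHomogeneous_X ℝ i)

lemma eq_of_apolarFunctional_eq {p q : MvPolynomial (Fin 2) ℝ} (hp : p.IsHomogeneous 6)
    (hq : q.IsHomogeneous 6)
    (h : ∀ g : ℝ[X], g.natDegree ≤ 6 → apolarFunctional p g = apolarFunctional q g) : p = q := by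
  ext d
  by_cases hd : d.degree = 6
  · have hd2 : d 0 + d 1 = 6 := by
      rw [Finsupp.degree_eq_sum, Fin.sum_univ_two] at hd
      exact hd
    have hde : d = sexticExp (d 1) := by
      ext i
      fin_cases i
      · simp [sexticExp]; omega
      · simp [sexticExp]
    have h1 := h (X ^ (d 1)) (by rw [natDegree_X_pow]; omega)
    have hc : (Nat.choose 6 (d 1) : ℝ) ≠ 0 := by
      exact_mod_cast (Nat.choose_pos (by omega)).ne'
    have key : ∀ r : MvPolynomial (Fin 2) ℝ, apolarFunctional r (X ^ (d 1)) =
        r.coeff d * (Nat.choose 6 (d 1) : ℝ)⁻¹ := by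
      intro r
      rw [apolarFunctional_apply, Finset.sum_eq_single (d 1)]
      · rw [← hde]; simp
      · intro j _ hj
        rw [coeff_X_pow, if_neg hj]; simp
      · intro hn
        exact absurd (Finset.mem_range.2 (by omega)) hn
    rw [key, key] at h1
    exact mul_right_cancel₀ (inv_ne_zero hc) h1
  · rw [hp.coeff_eq_zero hd, hq.coeff_eq_zero hd]

lemma represents_apolarFunctional_iff {p : MvPolynomial (Fin 2) ℝ} (hp : p.IsHomogeneous 6)
    (f : Option ℝ →₀ ℝ) : Represents (apolarFunctional p) f ↔
      p = f.sum fun x c => MvPolynomial.C c * linearForm (pointVec x) ^ 6 := by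
  have key : ∀ g : ℝ[X], g.natDegree ≤ 6 →
      apolarFunctional (f.sum fun x c => MvPolynomial.C c * linearForm (pointVec x) ^ 6) g =
        f.sum fun x c => c * pointEval 6 x g := by
    intro g hg
    rw [Finsupp.sum, map_sum, LinearMap.sum_apply]
    refine Finset.sum_congr rfl fun x _ => ?_
    rw [← MvPolynomial.smul_eq_C_mul, map_smul, LinearMap.smul_apply,
      apolarFunctional_linearForm_pow x hg, smul_eq_mul]
  constructor
  · intro h
    refine eq_of_apolarFunctional_eq hp ?_ fun g hg => (h g hg).trans (key g hg).symm
    refine MvPolynomial.IsHomogeneous.sum _ _ _ fun x _ => ?_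
    simpa using (MvPolynomial.isHomogeneous_C _ (f x)).mul
      ((isHomogeneous_linearForm (pointVec x)).pow 6)
  · intro h g hg
    rw [← key g hg, ← h]

lemma linearForm_smul {n : ℕ} (c : ℝ) (α : Fin n → ℝ) :
    linearForm (c • α) = MvPolynomial.C c * linearForm α := by
  simp [linearForm, Finset.mul_sum, mul_assoc]

lemma exists_smul_pointVec {α : Fin 2 → ℝ} (hα : α ≠ 0) :
    ∃ (c : ℝ) (x : Option ℝ), c ≠ 0 ∧ α = c • pointVec x := by
  by_cases h0 : α 0 = 0
  · refine ⟨α 1, none, fun h1 => hα ?_, ?_⟩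
    · ext i; fin_cases i <;> simpa
    · ext i; fin_cases i <;> simp [pointVec, h0]
  · refine ⟨α 0, some (α 1 / α 0), h0, ?_⟩
    ext i; fin_cases i
    · simp [pointVec]
    · simp [pointVec]; field_simp

lemma pointVec_ne_zero (x : Option ℝ) : pointVec x ≠ 0 := by
  intro h
  cases x with
  | none => simpa [pointVec] using congrFun h 1
  | some s => simpa [pointVec] using congrFun h 0

lemma linearIndependent_pointVec {x y : Option ℝ} (h : x ≠ y) :
    LinearIndependent ℝ ![pointVec x, pointVec y] := by
  rw [LinearIndependent.pair_iff]
  intro a b hab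
  have h0 := congrFun hab 0
  have h1 := congrFun hab 1
  cases x with
  | none =>
    cases y with
    | none => exact absurd rfl h
    | some t =>
      simp [pointVec] at h0 h1
      subst h0
      simpa using h1
  | some s =>
    cases y with
    | none =>
      simp [pointVec] at h0 h1
      subst h0
      simpa using h1
    | some t =>
      simp only [pointVec, Pi.add_apply, Pi.smul_apply, Matrix.cons_val_zero, Matrix.cons_val_one,
        smul_eq_mul, mul_one, Pi.zero_apply] at h0 h1
      have hb : b = -a := by linarith
      subst hb
      have hst : s - t ≠ 0 := sub_ne_zero.2 fun e => h (by rw [e])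
      have ha : a = 0 := (mul_eq_zero.1 (by linarith : a * (s - t) = 0)).resolve_right hst
      simp [ha]

lemma badge_eq {r : ℕ} {lam : Fin r → ℝ} {f : Option ℝ →₀ ℝ} (e : Fin r ↪ Option ℝ)
    (hs : ∀ x ∈ f.support, x ∈ Set.range e) (hpos : ∀ j, 0 < f (e j) ↔ 0 < lam j)
    (hneg : ∀ j, f (e j) < 0 ↔ lam j < 0) : badge lam = (numPos f, numPos (-f)) := by
  classical
  rw [badge, numPos, numPos, Prod.mk.injEq]
  constructor
  · rw [← Finset.card_map e]
    congr 1
    ext x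
    rw [Finset.mem_map, Finset.mem_filter]
    constructor
    · rintro ⟨j, hj, rfl⟩
      have := (hpos j).2 (Finset.mem_filter.1 hj).2
      exact ⟨Finsupp.mem_support_iff.2 this.ne', this⟩
    · rintro ⟨hx, hx0⟩
      obtain ⟨j, rfl⟩ := hs x hx
      exact ⟨j, Finset.mem_filter.2 ⟨Finset.mem_univ _, (hpos j).1 hx0⟩, rfl⟩
  · rw [← Finset.card_map e]
    congr 1
    ext x
    rw [Finset.mem_map, Finset.mem_filter, Finsupp.support_neg, Finsupp.neg_apply]
    constructor
    · rintro ⟨j, hj, rfl⟩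
      have := (hneg j).2 (Finset.mem_filter.1 hj).2
      exact ⟨Finsupp.mem_support_iff.2 this.ne, neg_pos.2 this⟩
    · rintro ⟨hx, hx0⟩
      obtain ⟨j, rfl⟩ := hs x hx
      exact ⟨j, Finset.mem_filter.2 ⟨Finset.mem_univ _, (hneg j).1 (neg_pos.1 hx0)⟩, rfl⟩

/-- Normalizing a linear form to a `pointVec` multiplies its coefficient by a positive sixth power,
so signs survive; non-proportional forms give distinct points. -/
lemma mem_badges_iff {p : MvPolynomial (Fin 2) ℝ} (hp : p.IsHomogeneous 6) (ab : ℕ × ℕ) :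
    ab ∈ badges 3 p ↔ ∃ f, Represents (apolarFunctional p) f ∧
      numPos f = ab.1 ∧ numPos (-f) = ab.2 := by
  classical
  constructor
  · rintro ⟨r, lam, α, hrep, rfl⟩
    choose c x hc hα using fun j => exists_smul_pointVec (hrep.form_ne_zero j)
    have hx : Function.Injective x := by
      intro j k hjk
      by_contra hne
      have h := LinearIndependent.pair_iff.1 (hrep.distinct j k hne) (c k) (-c j) (by
        rw [hα j, hα k, hjk, smul_smul, smul_smul, neg_mul, neg_smul, mul_comm, add_neg_cancel])
      exact hc k h.1
    let e : Fin r ↪ Option ℝ := ⟨x, hx⟩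
    let w : Fin r →₀ ℝ := Finsupp.equivFunOnFinite.symm fun j => lam j * c j ^ 6
    have hw : ∀ j, w.embDomain e (e j) = lam j * c j ^ 6 := fun j =>
      Finsupp.embDomain_apply_self e w j
    have hc6 : ∀ j, 0 < c j ^ 6 := fun j => by have := hc j; positivity
    refine ⟨w.embDomain e, (represents_apolarFunctional_iff hp _).2 ?_, Prod.mk.inj
      (badge_eq e (fun y hy => ?_) (fun j => ?_) fun j => ?_).symm⟩
    · rw [Finsupp.sum_embDomain, Finsupp.sum_fintype _ _ (by simp)]
      refine hrep.eq_sum.trans (Finset.sum_congr rfl fun j _ => ?_)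
      rw [hα j, linearForm_smul]
      change _ = MvPolynomial.C (lam j * c j ^ 6) * linearForm (pointVec (x j)) ^ 6
      rw [MvPolynomial.C_mul, MvPolynomial.C_pow]
      ring
    · rw [Finsupp.support_embDomain, Finset.mem_map] at hy
      obtain ⟨j, -, rfl⟩ := hy
      exact ⟨j, rfl⟩
    · rw [hw]; exact mul_pos_iff_of_pos_right (hc6 j)
    · rw [hw]; exact ⟨fun h => neg_of_mul_neg_left h (hc6 j).le, fun h => mul_neg_of_neg_of_pos h (hc6 j)⟩
  · obtain ⟨a, b⟩ := ab
    rintro ⟨f, hf, rfl, rfl⟩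
    let e := f.support.equivFin.symm
    have he : Function.Injective fun j => (e j : Option ℝ) :=
      Subtype.val_injective.comp e.injective
    refine ⟨f.support.card, fun j => f (e j), fun j => pointVec (e j), ⟨?_, ?_, ?_, ?_⟩,
      badge_eq ⟨_, he⟩ (fun x hx => ⟨e.symm ⟨x, hx⟩, by simp⟩) (fun _ => Iff.rfl)
        fun _ => Iff.rfl⟩
    · exact fun j => Finsupp.mem_support_iff.1 (e j).2
    · exact fun j => pointVec_ne_zero _
    · exact fun j k hjk => linearIndependent_pointVec (he.ne hjk)
    · rw [e.sum_comp fun x : f.support =>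
        MvPolynomial.C (f x) * linearForm (pointVec x) ^ (2 * 3), Finset.sum_coe_sort f.support
        fun x => MvPolynomial.C (f x) * linearForm (pointVec x) ^ (2 * 3)]
      exact (represents_apolarFunctional_iff hp f).1 hf

end RealForm

theorem corollary4p3 (p : MvPolynomial (Fin 2) ℝ) (hp : p.IsHomogeneous 6)
    (h : 2 ≤ (RealForm.signatures 3 p).encard) :
    RealForm.signatures 3 p = {(2, 3), (3, 2)} := by
  refine RealForm.minimal_badges_of_forall_not_isLeast (RealForm.mem_badges_iff hp)
    fun ab hab => ?_
  -- A least badge would be the only minimal one.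
  have hs : RealForm.signatures 3 p ⊆ {ab} := fun cd hcd =>
    Set.mem_singleton_iff.2 (le_antisymm (hcd.le_of_le hab.1 (hab.2 hcd.prop)) (hab.2 hcd.prop))
  have := h.trans (Set.encard_le_encard hs)
  rw [Set.encard_singleton] at this
  exact absurd this (by norm_num)
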